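/- Let $X$ be a real random variable whose distribution $F$ is absolutely continuous with density $f$. Suppose that $f$ is symmetric, $f(-x)=f(x)$ for all $x\in\mathbb R$, and that for some $x_0>1$ it is continuous and strictly positive on $\{x:|x|\ge x_0\}$. Suppose further that $$\int_{|x|\ge x_0}\frac{-\ln f(x)}{x^2\ln|x|}\,dx=\infty$$ and that the function $x\mapsto \dfrac{-\ln f(x)}{\ln x}$ is nondecreasing on $[x_0,\infty)$ and tends to $\infty$ as $x\to\infty$. Then all moments $m_k=\mathbf E[X^k]$ are finite and: 1. $X$ satisfies Carleman's condition $\sum_{k=1}^{\infty} (m_{2k})^{-1/(2k)}=\infty$; 2. $X$ is moment-determinate: $F$ is the only probability distribution on $\mathbb R$ with all moments finite and equal to $m_1,m_2,\ldots$; 3. $X^2$ is moment-determinate on $\mathbb R_+=[0,\infty)$: its distribution is the only probability distribution on $[0,\infty)$ with all moments finite and equal to $\mathbf E[X^{2k}]$, $k=1,2,\ldots$. -/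

import Mathlib

open MeasureTheory
open scoped ENNReal

namespace MomentProblem

/-- All moments of the measure `μ` on `ℝ` are finite. -/
def FiniteMoments (μ : Measure ℝ) : Prop :=
  ∀ k : ℕ, Integrable (fun x : ℝ => x ^ k) μ

/-- Carleman's condition (Hamburger case): all moments `m_k` of `μ` are finite and
`∑_{k ≥ 1} (m_{2k})^{-1/(2k)} = ∞`. The summation index is shifted by one, and the series is a
series in `[0, ∞]`, where `0 ^ (-1/(2k)) = ∞`. -/
def Carleman (μ : Measure ℝ) : Prop :=
  FiniteMoments μ ∧
    ∑' k : ℕ, ENNReal.ofReal (∫ x, x ^ (2 * (k + 1)) ∂μ) ^ (-1 / (2 * ((k : ℝ) + 1))) = ∞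

/-- `μ` is concentrated on `S`, has finite moments, and is the only probability measure
concentrated on `S` with its moments. -/
def MDeterminateOn (S : Set ℝ) (μ : Measure ℝ) : Prop :=
  μ Sᶜ = 0 ∧ FiniteMoments μ ∧
    ∀ ν : Measure ℝ, IsProbabilityMeasure ν → ν Sᶜ = 0 → FiniteMoments ν →
      (∀ k : ℕ, ∫ x, x ^ k ∂ν = ∫ x, x ^ k ∂μ) → ν = μ

/-- The integral of `g` over `s` exists in the extended sense and equals `+∞`: the positive part
has infinite integral, the negative part a finite one. -/
def IntegralEqTop (g : ℝ → ℝ) (s : Set ℝ) : Prop :=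
  ∫⁻ x in s, ENNReal.ofReal (g x) = ∞ ∧ ∫⁻ x in s, ENNReal.ofReal (-g x) < ∞

end MomentProblem

/-! Put `H x = -log f x / log x`, so that `f x = x ^ (-H x)` for large `x`. Let `b k` be the point
where the nondecreasing `H` passes the level `2 k + 4`. Beyond `b k` one has `x ^ (2 (k + 1)) * f x
≤ x ^ (-2)`, hence the moment of order `2 (k + 1)` is at most `3 * b k ^ (2 (k + 1))`, and the
corresponding Carleman term is at least `1 / (3 * b k)`. Since `H x ≤ 4 + 2 * #{k | b k ≤ x}` beyond
`x₀`, integrating against `x ^ (-2)` shows that `∫ H x / x ^ 2 = ∞` forces `∑ 1 / b k = ∞`. This is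
Carleman's condition (`carleman_withDensity`).

Determinacy then follows from quasi-analyticity. If `ν` has the moments of `μ`, the difference of
the characteristic functions has all derivatives zero at `0`, and its `n`-th derivative is bounded
by the absolute moment `M n` of `ν + μ`. The sequence `M` is log-convex. The products of its ratios
`M n / M (n + 1)` telescope, so Carleman's inequality turns Carleman's condition into `∑ M n / M (n
+ 1) = ∞`. The Denjoy–Carleman theorem (`eq_zero_of_flat_of_not_summable`, by Bang's method) makes
the difference vanish.

For the square, a competitor on the half-line lifts to the symmetric law of `± √Y`, which has the
moments of `X`; determinacy on the line identifies the two laws, and squaring returns to the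
half-line. -/

namespace MomentProblem

/-! ### Quasi-analyticity: the Denjoy–Carleman theorem by Bang's method. -/

section QuasiAnalytic

variable {E : Type*} [NormedAddCommGroup E] [NormedSpace ℝ E]

theorem hasDerivAt_pow_succ_div_factorial (j : ℕ) (x : ℝ) :
    HasDerivAt (fun x : ℝ => x ^ (j + 1) / ((j + 1).factorial : ℝ)) (x ^ j / (j.factorial : ℝ))
      x := by
  refine ((hasDerivAt_pow (j + 1) x).div_const ((j + 1).factorial : ℝ)).congr_deriv ?_
  have h3 : (j.factorial : ℝ) ≠ 0 := by positivity
  have h4 : (j : ℝ) + 1 ≠ 0 := by positivity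
  rw [Nat.factorial_succ]
  push_cast
  field_simp

/-- Taylor's formula to the right of `a`, for a function given together with all its derivatives:
`F (n + 1)` is the derivative of `F n`. -/
theorem norm_sub_taylor_le {F : ℕ → ℝ → E} (hF : ∀ n t, HasDerivAt (F n) (F (n + 1) t) t)
    {C : ℝ} (a : ℝ) (m n : ℕ) (hC : ∀ t, ‖F (n + m) t‖ ≤ C) {h : ℝ} (hh : 0 ≤ h) :
    ‖F n (a + h) - ∑ j ∈ Finset.range m, (h ^ j / (j.factorial : ℝ)) • F (n + j) a‖
      ≤ C * (h ^ m / (m.factorial : ℝ)) := by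
  induction m generalizing n h with
  | zero => simpa using hC (a + h)
  | succ m ih =>
    have hd : ∀ x : ℝ, HasDerivAt
        (fun x => F n (a + x) - ∑ j ∈ Finset.range (m + 1), (x ^ j / (j.factorial : ℝ)) • F (n + j) a)
        (F (n + 1) (a + x) - ∑ j ∈ Finset.range m, (x ^ j / (j.factorial : ℝ)) • F (n + 1 + j) a)
        x := by
      intro x
      have h1 : HasDerivAt (fun x => F n (a + x)) (F (n + 1) (a + x)) x := by
        simpa using (hF n (a + x)).comp_const_add a x
      refine h1.sub ?_
      simp only [Finset.sum_range_succ', pow_zero, Nat.factorial_zero, Nat.cast_one]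
      refine HasDerivAt.add_const (c := _) ?_
      refine HasDerivAt.fun_sum fun j _ => ?_
      have h5 : n + 1 + j = n + (j + 1) := by ring
      rw [h5]
      exact (hasDerivAt_pow_succ_div_factorial j x).smul_const _
    have hB : ∀ x : ℝ, HasDerivAt (fun x : ℝ => C * (x ^ (m + 1) / ((m + 1).factorial : ℝ)))
        (C * (x ^ m / (m.factorial : ℝ))) x :=
      fun x => (hasDerivAt_pow_succ_div_factorial m x).const_mul C
    refine image_norm_le_of_norm_deriv_right_le_deriv_boundary (a := 0) (b := h)
      (fun x _ => (hd x).continuousAt.continuousWithinAt)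
      (fun x _ => (hd x).hasDerivWithinAt) ?_ hB ?_ (Set.right_mem_Icc.2 hh)
    · simp [Finset.sum_range_succ']
    · intro x hx
      refine ih (n + 1) (fun t => ?_) hx.1
      have h5 : n + 1 + m = n + (m + 1) := by ring
      rw [h5]
      exact hC t

theorem ratio_monotone {M : ℕ → ℝ} (hM : ∀ n, 0 < M n)
    (hconv : ∀ n, M (n + 1) ^ 2 ≤ M n * M (n + 2)) : Monotone fun n => M (n + 1) / M n := by
  refine monotone_nat_of_le_succ fun n => ?_
  rw [div_le_div_iff₀ (hM n) (hM (n + 1))]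
  nlinarith [hconv n]

theorem le_mul_ratio_pow {M : ℕ → ℝ} (hM : ∀ n, 0 < M n)
    (hconv : ∀ n, M (n + 1) ^ 2 ≤ M n * M (n + 2)) {N : ℕ} (n j : ℕ) (hnj : n + j ≤ N + 1) :
    M (n + j) ≤ M n * (M (N + 1) / M N) ^ j := by
  induction j with
  | zero => simp
  | succ j ih =>
    have h1 : M (n + j + 1) / M (n + j) ≤ M (N + 1) / M N :=
      ratio_monotone hM hconv (by omega : n + j ≤ N)
    rw [div_le_iff₀ (hM _)] at h1
    have h2 : 0 < M (N + 1) / M N := div_pos (hM _) (hM _)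
    calc M (n + (j + 1)) ≤ M (N + 1) / M N * M (n + j) := h1
      _ ≤ M (N + 1) / M N * (M n * (M (N + 1) / M N) ^ j) :=
        mul_le_mul_of_nonneg_left (ih (by omega)) h2.le
      _ = M n * (M (N + 1) / M N) ^ (j + 1) := by ring

/-- Bang's estimate: moving by at most `M N / (e M (N + 1))` enlarges the normalized derivatives
at most by the factor `e`, from `e ^ (-(N + 1))` to `e ^ (-N)`. -/
theorem bang_step {F : ℕ → ℝ → E} (hF : ∀ n t, HasDerivAt (F n) (F (n + 1) t) t)
    {M : ℕ → ℝ} (hM : ∀ n, 0 < M n) (hconv : ∀ n, M (n + 1) ^ 2 ≤ M n * M (n + 2))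
    (hFM : ∀ n t, ‖F n t‖ ≤ M n) {N : ℕ} {a h : ℝ} (hh : 0 ≤ h)
    (hhN : h ≤ M N / M (N + 1) * Real.exp (-1))
    (ha : ∀ n : ℕ, ‖F n a‖ ≤ Real.exp (n - (N + 1)) * M n) (n : ℕ) :
    ‖F n (a + h)‖ ≤ Real.exp (n - N) * M n := by
  -- For `n ≥ N` the exponential factor is at least `1` and the global bound suffices.
  rcases le_or_gt N n with hn | hn
  · refine (hFM n _).trans (le_mul_of_one_le_left (hM n).le (Real.one_le_exp ?_))
    simpa using hn
  -- Expanding up to derivative `N + 1` makes the weight in `ha` equal to `1`, so the Taylor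
  -- remainder has the shape of one more term of the sum. With it the terms form a partial sum of
  -- the series of `exp (e r h)`, and `e r h ≤ 1` costs one factor `e`.
  obtain ⟨m, hm⟩ : ∃ m, n + m = N + 1 := ⟨N + 1 - n, by omega⟩
  set r := M (N + 1) / M N with hr
  have hr0 : 0 < r := div_pos (hM _) (hM _)
  have hx0 : 0 ≤ Real.exp 1 * r * h := by positivity
  have hx1 : Real.exp 1 * r * h ≤ 1 := by
    calc Real.exp 1 * r * h ≤ Real.exp 1 * r * (M N / M (N + 1) * Real.exp (-1)) := by gcongr
      _ = (Real.exp 1 * Real.exp (-1)) * (r * (M N / M (N + 1))) := by ring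
      _ = 1 := by
        rw [← Real.exp_add, hr, div_mul_div_comm, mul_comm (M N), div_self]
        · simp
        · exact mul_ne_zero (hM _).ne' (hM _).ne'
  have hterm : ∀ j, j ≤ m → h ^ j / (j.factorial : ℝ) * (Real.exp ((n + j : ℕ) - (N + 1)) * M (n + j))
      ≤ Real.exp (n - (N + 1)) * M n * ((Real.exp 1 * r * h) ^ j / (j.factorial : ℝ)) := by
    intro j hj
    have h1 : Real.exp ((n + j : ℕ) - (N + 1)) = Real.exp (n - (N + 1)) * Real.exp 1 ^ j := by
      rw [← Real.exp_nat_mul, ← Real.exp_add]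
      congr 1
      push_cast
      ring
    rw [h1]
    calc h ^ j / (j.factorial : ℝ) * (Real.exp (n - (N + 1)) * Real.exp 1 ^ j * M (n + j))
        ≤ h ^ j / (j.factorial : ℝ) * (Real.exp (n - (N + 1)) * Real.exp 1 ^ j * (M n * r ^ j)) := by
          gcongr
          exact le_mul_ratio_pow hM hconv n j (by omega)
      _ = _ := by ring
  have htaylor := norm_sub_taylor_le hF a m n (C := M (n + m)) (fun t => hFM _ t) hh
  have hlast : M (n + m) * (h ^ m / (m.factorial : ℝ)) =
      h ^ m / (m.factorial : ℝ) * (Real.exp ((n + m : ℕ) - (N + 1)) * M (n + m)) := by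
    have : ((n + m : ℕ) : ℝ) - (N + 1) = 0 := by rw [hm]; push_cast; ring
    rw [this]
    simp [mul_comm]
  have hsum : ‖∑ j ∈ Finset.range m, (h ^ j / (j.factorial : ℝ)) • F (n + j) a‖ ≤
      ∑ j ∈ Finset.range m,
        h ^ j / (j.factorial : ℝ) * (Real.exp ((n + j : ℕ) - (N + 1)) * M (n + j)) := by
    refine norm_sum_le_of_le _ fun j _ => ?_
    have h0 : 0 ≤ h ^ j / (j.factorial : ℝ) := by positivity
    rw [norm_smul, Real.norm_of_nonneg h0]
    exact mul_le_mul_of_nonneg_left (ha _) h0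
  calc ‖F n (a + h)‖
      ≤ ‖F n (a + h) - ∑ j ∈ Finset.range m, (h ^ j / (j.factorial : ℝ)) • F (n + j) a‖
        + ‖∑ j ∈ Finset.range m, (h ^ j / (j.factorial : ℝ)) • F (n + j) a‖ := by
        simpa using norm_add_le
          (F n (a + h) - ∑ j ∈ Finset.range m, (h ^ j / (j.factorial : ℝ)) • F (n + j) a)
          (∑ j ∈ Finset.range m, (h ^ j / (j.factorial : ℝ)) • F (n + j) a)
    _ ≤ ∑ j ∈ Finset.range (m + 1),
        h ^ j / (j.factorial : ℝ) * (Real.exp ((n + j : ℕ) - (N + 1)) * M (n + j)) := by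
        rw [Finset.sum_range_succ, ← hlast]
        linarith
    _ ≤ ∑ j ∈ Finset.range (m + 1),
        Real.exp (n - (N + 1)) * M n * ((Real.exp 1 * r * h) ^ j / (j.factorial : ℝ)) :=
        Finset.sum_le_sum fun j hj => hterm j (by simpa [Nat.lt_succ_iff] using hj)
    _ = Real.exp (n - (N + 1)) * M n *
        ∑ j ∈ Finset.range (m + 1), (Real.exp 1 * r * h) ^ j / (j.factorial : ℝ) := by
        rw [Finset.mul_sum]
    _ ≤ Real.exp (n - (N + 1)) * M n * Real.exp 1 := by
        have := hM n
        gcongr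
        exact (Real.sum_le_exp_of_nonneg hx0 _).trans (Real.exp_le_exp.2 hx1)
    _ = Real.exp (n - N) * M n := by
        rw [mul_right_comm, ← Real.exp_add]
        congr 2
        ring

/-- The iteration of `bang_step`, starting from a zero of infinite order. -/
theorem norm_le_of_le_sum_ratio {F : ℕ → ℝ → E} (hF : ∀ n t, HasDerivAt (F n) (F (n + 1) t) t)
    {M : ℕ → ℝ} (hM : ∀ n, 0 < M n) (hconv : ∀ n, M (n + 1) ^ 2 ≤ M n * M (n + 2))
    (hFM : ∀ n t, ‖F n t‖ ≤ M n) (h0 : ∀ n, F n 0 = 0) (i k : ℕ) {x : ℝ} (hx : 0 ≤ x)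
    (hxi : x ≤ ∑ j ∈ Finset.range i, M (k + j) / M (k + j + 1) * Real.exp (-1)) (n : ℕ) :
    ‖F n x‖ ≤ Real.exp (n - k) * M n := by
  induction i generalizing k x n with
  | zero =>
    obtain rfl : x = 0 := le_antisymm (by simpa using hxi) hx
    rw [h0, norm_zero]
    exact mul_nonneg (Real.exp_pos _).le (hM n).le
  | succ i ih =>
    set s := ∑ j ∈ Finset.range i, M (k + 1 + j) / M (k + 1 + j + 1) * Real.exp (-1) with hs
    have hs0 : 0 ≤ s := Finset.sum_nonneg fun j _ =>
      mul_nonneg (div_nonneg (hM _).le (hM _).le) (Real.exp_pos _).le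
    have hxs : x ≤ s + M k / M (k + 1) * Real.exp (-1) := by
      rw [Finset.sum_range_succ'] at hxi
      simpa [hs, add_assoc, add_comm 1] using hxi
    -- The indices are used in decreasing order: those above `k` carry the point to `min x s`, and
    -- index `k` covers the rest, a step of length zero when `x ≤ s`.
    have hstep := bang_step hF hM hconv hFM (N := k) (a := min x s) (h := x - min x s)
      (sub_nonneg.2 (min_le_left _ _)) ?_ (fun n => ?_) n
    · simpa using hstep
    · rcases le_total x s with h | h
      · rw [min_eq_left h, sub_self]
        exact mul_nonneg (div_nonneg (hM _).le (hM _).le) (Real.exp_pos _).le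
      · rw [min_eq_right h]
        linarith
    · have := ih (k + 1) (le_min hx hs0) (min_le_right x s) n
      simpa using this

/-- Every tail of the divergent series of ratios still diverges, so `x` is reached using only
indices from `k` on. This gives the bound `e ^ (-k) * M 0` for every `k`. -/
theorem eq_zero_of_nonneg_of_flat {F : ℕ → ℝ → E} (hF : ∀ n t, HasDerivAt (F n) (F (n + 1) t) t)
    {M : ℕ → ℝ} (hM : ∀ n, 0 < M n) (hconv : ∀ n, M (n + 1) ^ 2 ≤ M n * M (n + 2))
    (hdiv : ¬ Summable fun n => M n / M (n + 1))
    (hFM : ∀ n t, ‖F n t‖ ≤ M n) (h0 : ∀ n, F n 0 = 0) {x : ℝ} (hx : 0 ≤ x) : F 0 x = 0 := by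
  have key : ∀ k : ℕ, ‖F 0 x‖ ≤ Real.exp (-k) * M 0 := by
    intro k
    have hdiv' : ¬ Summable fun j => M (k + j) / M (k + j + 1) * Real.exp (-1) := by
      intro h
      rw [summable_mul_right_iff (Real.exp_pos _).ne'] at h
      refine hdiv ((summable_nat_add_iff k).1 ?_)
      simpa [add_comm, add_left_comm] using h
    have htop := (not_summable_iff_tendsto_nat_atTop_of_nonneg fun j =>
      mul_nonneg (div_nonneg (hM (k + j)).le (hM (k + j + 1)).le) (Real.exp_pos _).le).1 hdiv'
    obtain ⟨i, hi⟩ := (htop.eventually_ge_atTop x).exists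
    simpa using norm_le_of_le_sum_ratio hF hM hconv hFM h0 i k hx hi 0
  have hlim : Filter.Tendsto (fun k : ℕ => Real.exp (-k) * M 0) Filter.atTop (nhds 0) := by
    have := (Real.tendsto_exp_neg_atTop_nhds_zero.comp
      (tendsto_natCast_atTop_atTop (R := ℝ))).mul_const (M 0)
    simpa using this
  exact norm_le_zero_iff.1 (ge_of_tendsto' hlim key)

/-- **Denjoy–Carleman theorem**: a smooth function whose derivatives are bounded by a positive
log-convex sequence `M` with `∑ M n / M (n + 1) = ∞` vanishes if it has a zero of infinite
order. -/
theorem eq_zero_of_flat_of_not_summable {f : ℝ → E} (hf : ∀ n : ℕ, ContDiff ℝ n f)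
    {M : ℕ → ℝ} (hM : ∀ n, 0 < M n) (hconv : ∀ n, M (n + 1) ^ 2 ≤ M n * M (n + 2))
    (hdiv : ¬ Summable fun n => M n / M (n + 1))
    (hfM : ∀ n t, ‖iteratedDeriv n f t‖ ≤ M n) (h0 : ∀ n, iteratedDeriv n f 0 = 0) (x : ℝ) :
    f x = 0 := by
  have hd : ∀ n t, HasDerivAt (iteratedDeriv n f) (iteratedDeriv (n + 1) f t) t := by
    intro n t
    rw [iteratedDeriv_succ]
    exact ((hf (n + 1)).differentiable_iteratedDeriv n (by exact_mod_cast n.lt_succ_self)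
      t).hasDerivAt
  rcases le_total 0 x with hx | hx
  · simpa using eq_zero_of_nonneg_of_flat hd hM hconv hdiv hfM h0 hx
  · have hd' : ∀ n t, HasDerivAt (fun t => (-1 : ℝ) ^ n • iteratedDeriv n f (-t))
        ((-1 : ℝ) ^ (n + 1) • iteratedDeriv (n + 1) f (-t)) t := by
      intro n t
      have := ((hd n (-t)).scomp t (hasDerivAt_neg t)).const_smul ((-1 : ℝ) ^ n)
      rw [smul_smul, ← pow_succ] at this
      exact this
    have := eq_zero_of_nonneg_of_flat hd' hM hconv hdiv
      (fun n t => by simpa [norm_smul] using hfM n (-t)) (fun n => by simp [h0])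
      (neg_nonneg.2 hx)
    simpa using this

end QuasiAnalytic

/-! ### Carleman's inequality. -/

/-- Exchange the sums and telescope `1 / ((n + 1) (n + 2)) = 1 / (n + 1) - 1 / (n + 2)`. -/
theorem sum_weighted_mean_eq (a : ℕ → ℝ) (N : ℕ) :
    ∑ n ∈ Finset.range N,
        (∑ j ∈ Finset.range (n + 1), ((j : ℝ) + 1) * a j) / (((n : ℝ) + 1) * ((n : ℝ) + 2)) =
      ∑ j ∈ Finset.range N, a j -
        (∑ j ∈ Finset.range N, ((j : ℝ) + 1) * a j) / ((N : ℝ) + 1) := by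
  induction N with
  | zero => simp
  | succ N ih =>
    rw [Finset.sum_range_succ, ih, Finset.sum_range_succ a, Finset.sum_range_succ _ N]
    have h1 : (N : ℝ) + 1 ≠ 0 := by positivity
    have h2 : (N : ℝ) + 2 ≠ 0 := by positivity
    have h3 : (N : ℝ) + 1 + 1 ≠ 0 := by positivity
    push_cast
    field_simp
    ring

/-- AM–GM is applied to `(j + 1) * a j`; the extra factor `(n + 1)! ^ (1 / (n + 1))` is at least `(n
+ 1) / e`. The `2` comes from `n + 2 ≤ 2 (n + 1)`. -/
theorem geom_mean_le_weighted_mean {a : ℕ → ℝ} (ha : ∀ n, 0 ≤ a n) (n : ℕ) :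
    (∏ j ∈ Finset.range (n + 1), a j) ^ (1 / ((n : ℝ) + 1)) ≤ 2 * Real.exp 1 *
      ((∑ j ∈ Finset.range (n + 1), ((j : ℝ) + 1) * a j) / (((n : ℝ) + 1) * ((n : ℝ) + 2))) := by
  set G := (∏ j ∈ Finset.range (n + 1), a j) ^ (1 / ((n : ℝ) + 1)) with hG
  set S := ∑ j ∈ Finset.range (n + 1), ((j : ℝ) + 1) * a j with hS
  have hG0 : 0 ≤ G := Real.rpow_nonneg (Finset.prod_nonneg fun j _ => ha j) _
  have hS0 : 0 ≤ S := Finset.sum_nonneg fun j _ => mul_nonneg (by positivity) (ha j)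
  have hn : (0 : ℝ) < (n : ℝ) + 1 := by positivity
  have hamgm := Real.geom_mean_le_arith_mean (Finset.range (n + 1)) (fun _ => 1)
    (fun j => ((j : ℝ) + 1) * a j) (fun _ _ => zero_le_one) (by simpa using hn)
    (fun j _ => mul_nonneg (by positivity) (ha j))
  have hfact : ∏ j ∈ Finset.range (n + 1), ((j : ℝ) + 1) = ((n + 1).factorial : ℝ) := by
    rw [← Finset.prod_range_add_one_eq_factorial]
    push_cast
    rfl
  simp only [Real.rpow_one, Finset.sum_const, Finset.card_range, nsmul_eq_mul, mul_one, one_mul,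
    Finset.prod_mul_distrib, hfact, Nat.cast_add, Nat.cast_one] at hamgm
  rw [Real.mul_rpow (by positivity) (Finset.prod_nonneg fun j _ => ha j), ← one_div, ← hG, ← hS]
    at hamgm
  have hstirling : ((n : ℝ) + 1) / Real.exp 1 ≤ ((n + 1).factorial : ℝ) ^ (1 / ((n : ℝ) + 1)) := by
    have h1 := Real.pow_div_factorial_le_exp (x := (n : ℝ) + 1) hn.le (n + 1)
    have h2 : (((n : ℝ) + 1) / Real.exp 1) ^ (n + 1) ≤ ((n + 1).factorial : ℝ) := by
      rw [div_le_iff₀ (by positivity)] at h1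
      rw [div_pow, div_le_iff₀ (by positivity), ← Real.exp_nat_mul, mul_comm]
      simpa using h1
    have h3 := Real.rpow_le_rpow (by positivity) h2 (by positivity : 0 ≤ 1 / ((n : ℝ) + 1))
    rw [← Real.rpow_natCast, ← Real.rpow_mul (by positivity)] at h3
    have h4 : ((n + 1 : ℕ) : ℝ) * (1 / ((n : ℝ) + 1)) = 1 := by
      push_cast
      field_simp
    rwa [h4, Real.rpow_one] at h3
  have h5 : ((n : ℝ) + 1) / Real.exp 1 * G ≤ S / ((n : ℝ) + 1) :=
    (mul_le_mul_of_nonneg_right hstirling hG0).trans hamgm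
  have h6 : G ≤ Real.exp 1 * (S / (((n : ℝ) + 1) * ((n : ℝ) + 1))) := by
    have h7 : G = Real.exp 1 / ((n : ℝ) + 1) * (((n : ℝ) + 1) / Real.exp 1 * G) := by
      have := Real.exp_pos 1
      field_simp
    rw [h7]
    calc _ ≤ Real.exp 1 / ((n : ℝ) + 1) * (S / ((n : ℝ) + 1)) := by gcongr
      _ = _ := by field_simp
  have h8 : S / (((n : ℝ) + 1) * ((n : ℝ) + 1)) ≤ 2 * (S / (((n : ℝ) + 1) * ((n : ℝ) + 2))) := by
    rw [← mul_div_assoc, div_le_div_iff₀ (by positivity) (by positivity)]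
    have : ((n : ℝ) + 1) * ((n : ℝ) + 2) ≤ 2 * (((n : ℝ) + 1) * ((n : ℝ) + 1)) := by nlinarith
    nlinarith
  calc G ≤ Real.exp 1 * (S / (((n : ℝ) + 1) * ((n : ℝ) + 1))) := h6
    _ ≤ Real.exp 1 * (2 * (S / (((n : ℝ) + 1) * ((n : ℝ) + 2)))) := by gcongr
    _ = _ := by ring

/-- **Carleman's inequality**, in qualitative form: the geometric means of a summable sequence of
nonnegative numbers are summable. -/
theorem summable_geom_mean {a : ℕ → ℝ} (ha : ∀ n, 0 ≤ a n) (hsum : Summable a) :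
    Summable fun n : ℕ => (∏ j ∈ Finset.range (n + 1), a j) ^ (1 / ((n : ℝ) + 1)) := by
  refine Summable.of_nonneg_of_le
    (fun n => Real.rpow_nonneg (Finset.prod_nonneg fun j _ => ha j) _)
    (geom_mean_le_weighted_mean ha) (Summable.mul_left _ ?_)
  refine summable_of_sum_range_le (c := ∑' j, a j) (fun n => ?_) fun N => ?_
  · exact div_nonneg (Finset.sum_nonneg fun j _ => mul_nonneg (by positivity) (ha j))
      (by positivity)
  · rw [sum_weighted_mean_eq]
    have h1 : 0 ≤ (∑ j ∈ Finset.range N, ((j : ℝ) + 1) * a j) / ((N : ℝ) + 1) :=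
      div_nonneg (Finset.sum_nonneg fun j _ => mul_nonneg (by positivity) (ha j)) (by positivity)
    have h2 := hsum.sum_le_tsum (Finset.range N) fun j _ => ha j
    linarith

/-! ### Carleman's criterion through characteristic functions. -/

theorem FiniteMoments.integrable_abs_pow {μ : Measure ℝ} (hμ : FiniteMoments μ) (k : ℕ) :
    Integrable (fun x : ℝ => |x| ^ k) μ := by
  simpa [abs_pow] using (hμ k).abs

theorem FiniteMoments.memLp_id {μ : Measure ℝ} (hμ : FiniteMoments μ) (k : ℕ) :
    MemLp id (k : ℝ≥0∞) μ := by
  rcases eq_or_ne k 0 with rfl | hk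
  · simpa using aestronglyMeasurable_id
  · have h := (integrable_norm_rpow_iff (μ := μ) (f := (id : ℝ → ℝ)) (p := (k : ℝ≥0∞))
      aestronglyMeasurable_id (by exact_mod_cast hk) (by simp)).1 ?_
    · exact h
    · simpa using hμ.integrable_abs_pow k

/-- Cauchy–Schwarz in discriminant form: the integral of `|x| ^ n * (B - A * |x|) ^ 2` is `A * (A *
C - B ^ 2)`. -/
theorem log_convex_integral_abs_pow {ρ : Measure ℝ} (hρ : FiniteMoments ρ)
    (hpos : ∀ n, 0 < ∫ x, |x| ^ n ∂ρ) (n : ℕ) :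
    (∫ x, |x| ^ (n + 1) ∂ρ) ^ 2 ≤ (∫ x, |x| ^ n ∂ρ) * ∫ x, |x| ^ (n + 2) ∂ρ := by
  set A := ∫ x, |x| ^ n ∂ρ with hA
  set B := ∫ x, |x| ^ (n + 1) ∂ρ with hB
  set C := ∫ x, |x| ^ (n + 2) ∂ρ with hC
  have hq : ∫ x, |x| ^ n * (B - A * |x|) ^ 2 ∂ρ = B ^ 2 * A - 2 * A * B * B + A ^ 2 * C := by
    have h0 := (hρ.integrable_abs_pow n).const_mul (B ^ 2)
    have h1 := (hρ.integrable_abs_pow (n + 1)).const_mul (2 * A * B)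
    have h2 := (hρ.integrable_abs_pow (n + 2)).const_mul (A ^ 2)
    have heq : ∀ x : ℝ, |x| ^ n * (B - A * |x|) ^ 2 =
        B ^ 2 * |x| ^ n - 2 * A * B * |x| ^ (n + 1) + A ^ 2 * |x| ^ (n + 2) := fun x => by ring
    simp only [heq]
    have h01 : Integrable (fun x : ℝ => B ^ 2 * |x| ^ n - 2 * A * B * |x| ^ (n + 1)) ρ := h0.sub h1
    rw [integral_add h01 h2, integral_sub h0 h1, integral_const_mul, integral_const_mul,
      integral_const_mul]
  have hnn : 0 ≤ ∫ x, |x| ^ n * (B - A * |x|) ^ 2 ∂ρ := integral_nonneg fun x => by positivity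
  have hA0 : 0 < A := hpos n
  rw [hq] at hnn
  have : 0 ≤ A * (A * C - B ^ 2) := by nlinarith
  have := nonneg_of_mul_nonneg_right this hA0
  linarith

theorem prod_range_ratio {M : ℕ → ℝ} (hM : ∀ n, 0 < M n) (n : ℕ) :
    ∏ j ∈ Finset.range n, M j / M (j + 1) = M 0 / M n := by
  induction n with
  | zero => simp [(hM 0).ne']
  | succ n ih => rw [Finset.prod_range_succ, ih, div_mul_div_cancel₀ (hM n).ne']

/-- Under Carleman's condition the ratios of consecutive terms of a positive sequence `M` with
`M (2 * k) = c * m (2 * k)`, `M 0 = c`, are not summable. -/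
theorem Carleman.not_summable_ratio {μ : Measure ℝ} (hμ : Carleman μ) {M : ℕ → ℝ}
    (hM : ∀ n, 0 < M n) (hMm : ∀ k, M (2 * k) = M 0 * ∫ x, x ^ (2 * k) ∂μ) :
    ¬ Summable fun n => M n / M (n + 1) := by
  intro hsum
  have h1 := summable_geom_mean (fun n => div_nonneg (hM n).le (hM (n + 1)).le) hsum
  -- The geometric mean of index `2 k + 1` involves `2 (k + 1)` ratios, whose product is `M 0 / M (2
  -- (k + 1))`; it is exactly the `k`-th Carleman term.
  have h2 := h1.comp_injective (i := fun k : ℕ => 2 * k + 1) fun a b hab => by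
    simpa using hab
  have h3 : ∀ k : ℕ, ENNReal.ofReal (∫ x, x ^ (2 * (k + 1)) ∂μ) ^ (-1 / (2 * ((k : ℝ) + 1))) =
      ENNReal.ofReal ((∏ j ∈ Finset.range (2 * k + 1 + 1), M j / M (j + 1)) ^
        (1 / (((2 * k + 1 : ℕ) : ℝ) + 1))) := by
    intro k
    have h4 := hMm (k + 1)
    have h5 : 0 < ∫ x, x ^ (2 * (k + 1)) ∂μ := by
      have := hM (2 * (k + 1))
      rw [h4] at this
      exact pos_of_mul_pos_right this (hM 0).le
    rw [prod_range_ratio hM, ENNReal.ofReal_rpow_of_pos h5]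
    congr 1
    rw [show 2 * k + 1 + 1 = 2 * (k + 1) by ring, h4, div_mul_cancel_left₀ (hM 0).ne',
      Real.inv_rpow h5.le, ← Real.rpow_neg h5.le]
    congr 1
    push_cast
    ring
  have h6 := hμ.2
  simp only [h3] at h6
  exact h2.tsum_ofReal_ne_top h6

theorem charFun_eq_one_of_integral_sq_eq_zero {μ : Measure ℝ} [IsProbabilityMeasure μ]
    (hμ : FiniteMoments μ) (h : ∫ x, x ^ 2 ∂μ = 0) (t : ℝ) : charFun μ t = 1 := by
  have h1 := (integral_eq_zero_iff_of_nonneg (fun x => sq_nonneg x) (hμ 2)).1 h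
  rw [charFun_apply_real]
  have h2 : (fun x : ℝ => Complex.exp (t * x * Complex.I)) =ᵐ[μ] fun _ => 1 := by
    filter_upwards [h1] with x hx
    have : x = 0 := by simpa using hx
    simp [this]
  rw [integral_congr_ae h2]
  simp

theorem norm_iteratedDeriv_charFun_le {μ : Measure ℝ} [IsProbabilityMeasure μ]
    (hμ : FiniteMoments μ) (n : ℕ) (t : ℝ) :
    ‖iteratedDeriv n (charFun μ) t‖ ≤ ∫ x, |x| ^ n ∂μ := by
  rw [iteratedDeriv_charFun (hμ.memLp_id n), norm_mul, norm_pow, Complex.norm_I, one_pow, one_mul]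
  refine (norm_integral_le_integral_norm _).trans_eq (integral_congr_ae (.of_forall fun x => ?_))
  have : ‖Complex.exp (t * x * Complex.I)‖ = 1 := by
    rw [← Complex.ofReal_mul, Complex.norm_exp_ofReal_mul_I]
  simp only [norm_mul, this, mul_one, norm_pow, Complex.norm_real, Real.norm_eq_abs]

/-- **Carleman's theorem** for the Hamburger moment problem. -/
theorem Carleman.eq_of_moments_eq {μ ν : Measure ℝ} [IsProbabilityMeasure μ]
    [IsProbabilityMeasure ν] (hμ : Carleman μ) (hν : FiniteMoments ν)
    (hmom : ∀ k : ℕ, ∫ x, x ^ k ∂ν = ∫ x, x ^ k ∂μ) : ν = μ := by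
  refine Measure.ext_of_charFun (funext fun t => ?_)
  -- The point mass at `0` is treated apart: its absolute moments of positive order vanish, so `M`
  -- would not be positive.
  rcases eq_or_ne (∫ x, x ^ 2 ∂μ) 0 with hdeg | hdeg
  · rw [charFun_eq_one_of_integral_sq_eq_zero hμ.1 hdeg,
      charFun_eq_one_of_integral_sq_eq_zero hν ((hmom 2).trans hdeg)]
  set M : ℕ → ℝ := fun n => ∫ x, |x| ^ n ∂(ν + μ) with hM
  have hρ : FiniteMoments (ν + μ) := fun k => (hν k).add_measure (hμ.1 k)
  have hMadd : ∀ n, M n = ∫ x, |x| ^ n ∂ν + ∫ x, |x| ^ n ∂μ := fun n =>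
    integral_add_measure (hν.integrable_abs_pow n) (hμ.1.integrable_abs_pow n)
  have hMpos : ∀ n, 0 < M n := by
    intro n
    refine lt_of_le_of_ne (integral_nonneg fun x => by positivity) fun h => hdeg ?_
    have h1 := (integral_eq_zero_iff_of_nonneg (fun x => by positivity)
      (hρ.integrable_abs_pow n)).1 h.symm
    have h2 := (ae_add_measure_iff.1 h1).2
    refine integral_eq_zero_of_ae ?_
    filter_upwards [h2] with x hx
    have : x = 0 := abs_eq_zero.1 (eq_zero_of_pow_eq_zero hx)
    simp [this]
  have hMeven : ∀ k, M (2 * k) = M 0 * ∫ x, x ^ (2 * k) ∂μ := by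
    intro k
    rw [hMadd, hMadd]
    have : ∀ x : ℝ, |x| ^ (2 * k) = x ^ (2 * k) := fun x => (even_two_mul k).pow_abs x
    simp only [this, hmom]
    simp
    ring
  have hzero := eq_zero_of_flat_of_not_summable (f := charFun ν - charFun μ) (M := M)
    (fun n => (contDiff_charFun (hν.memLp_id n)).sub (contDiff_charFun (hμ.1.memLp_id n)))
    hMpos (log_convex_integral_abs_pow hρ hMpos) (hμ.not_summable_ratio hMpos hMeven)
  have hsub : ∀ (n : ℕ) (t : ℝ), iteratedDeriv n (charFun ν - charFun μ) t =
      iteratedDeriv n (charFun ν) t - iteratedDeriv n (charFun μ) t := fun n t =>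
    iteratedDeriv_sub (contDiff_charFun (hν.memLp_id n)).contDiffAt
      (contDiff_charFun (hμ.1.memLp_id n)).contDiffAt
  refine sub_eq_zero.1 (hzero (fun n t => ?_) (fun n => ?_) t)
  · rw [hsub, hMadd]
    exact (norm_sub_le _ _).trans (add_le_add (norm_iteratedDeriv_charFun_le hν n t)
      (norm_iteratedDeriv_charFun_le hμ.1 n t))
  · rw [hsub, iteratedDeriv_charFun_zero (hν.memLp_id n), iteratedDeriv_charFun_zero
      (hμ.1.memLp_id n), hmom, sub_self]

/-! ### From the logarithmic integral of the density to Carleman's condition. -/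

theorem lintegral_Ioi_rpow_neg_two {a : ℝ} (ha : 0 < a) :
    ∫⁻ x in Set.Ioi a, ENNReal.ofReal (x ^ (-2 : ℝ)) = ENNReal.ofReal a⁻¹ := by
  rw [← ofReal_integral_eq_lintegral_ofReal (integrableOn_Ioi_rpow_of_lt (by norm_num) ha),
    integral_Ioi_rpow_of_lt (by norm_num) ha]
  · congr 1
    norm_num [Real.rpow_neg_one]
  · filter_upwards [ae_restrict_mem measurableSet_Ioi] with x hx
    exact Real.rpow_nonneg (ha.trans hx).le _

theorem setLIntegral_le_abs_le_of_even {φ : ℝ → ℝ≥0∞} (hφ : ∀ x, φ (-x) = φ x) (a : ℝ) :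
    ∫⁻ x in {x : ℝ | a ≤ |x|}, φ x ≤ 2 * ∫⁻ x in Set.Ioi a, φ x := by
  have hset : {x : ℝ | a ≤ |x|} = Set.Ici a ∪ Set.Iic (-a) := by
    ext x
    simp [le_abs, le_neg]
  have hneg : ∫⁻ x in Set.Iic (-a), φ x = ∫⁻ x in Set.Ici a, φ x := by
    have h := (Measure.measurePreserving_neg (volume : Measure ℝ)).setLIntegral_comp_preimage_emb
      (MeasurableEquiv.neg ℝ).measurableEmbedding φ (Set.Iic (-a))
    rw [← h]
    simp [hφ]
  rw [hset]
  refine (lintegral_union_le _ _ _).trans_eq ?_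
  rw [hneg, setLIntegral_congr Ioi_ae_eq_Ici.symm, two_mul]

/-- Moment bound for a symmetric density that decays like `x ^ (-(2 n + 2))` beyond `a`. -/
theorem lintegral_pow_withDensity_le {f : ℝ → ℝ} (hf : Measurable f)
    (hsymm : ∀ x, f (-x) = f x)
    [IsProbabilityMeasure (volume.withDensity fun x => ENNReal.ofReal (f x))]
    {a : ℝ} (ha : 1 ≤ a) {n : ℕ} (hdecay : ∀ x, a < x → x ^ (2 * n) * f x ≤ x ^ (-2 : ℝ)) :
    ∫⁻ x, ENNReal.ofReal (x ^ (2 * n)) ∂(volume.withDensity fun x => ENNReal.ofReal (f x)) ≤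
      ENNReal.ofReal (3 * a ^ (2 * n)) := by
  set μ : Measure ℝ := volume.withDensity fun x => ENNReal.ofReal (f x) with hμ
  have hs : MeasurableSet {x : ℝ | a ≤ |x|} := measurableSet_le measurable_const (by fun_prop)
  rw [← lintegral_add_compl _ hs]
  have hpow : 1 ≤ a ^ (2 * n) := one_le_pow₀ ha
  -- Each of the two tails contributes at most `1 / a ≤ 1`.
  have hfar : ∫⁻ x in {x : ℝ | a ≤ |x|}, ENNReal.ofReal (x ^ (2 * n)) ∂μ ≤ 2 := by
    rw [hμ, restrict_withDensity hs, lintegral_withDensity_eq_lintegral_mul _ (by fun_prop)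
      (by fun_prop)]
    have heven := setLIntegral_le_abs_le_of_even
      (φ := (fun x => ENNReal.ofReal (f x)) * fun x => ENNReal.ofReal (x ^ (2 * n)))
      (fun x => by simp [hsymm, pow_mul]) a
    refine heven.trans ?_
    have h1 : ∫⁻ x in Set.Ioi a,
        ((fun x => ENNReal.ofReal (f x)) * fun x => ENNReal.ofReal (x ^ (2 * n))) x ≤ 1 := by
      calc _ ≤ ∫⁻ x in Set.Ioi a, ENNReal.ofReal (x ^ (-2 : ℝ)) := by
            refine setLIntegral_mono' measurableSet_Ioi fun x hx => ?_
            have hx0 : (0 : ℝ) ≤ x ^ (2 * n) := by rw [pow_mul]; positivity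
            rw [Pi.mul_apply, mul_comm, ← ENNReal.ofReal_mul hx0]
            exact ENNReal.ofReal_le_ofReal (hdecay x hx)
        _ = ENNReal.ofReal a⁻¹ := lintegral_Ioi_rpow_neg_two (by linarith)
        _ ≤ 1 := ENNReal.ofReal_le_one.2 (inv_le_one_of_one_le₀ ha)
    calc _ ≤ 2 * (1 : ℝ≥0∞) := by gcongr
      _ = 2 := mul_one 2
  have hnear : ∫⁻ x in {x : ℝ | a ≤ |x|}ᶜ, ENNReal.ofReal (x ^ (2 * n)) ∂μ ≤
      ENNReal.ofReal (a ^ (2 * n)) := by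
    calc _ ≤ ∫⁻ _ in {x : ℝ | a ≤ |x|}ᶜ, ENNReal.ofReal (a ^ (2 * n)) ∂μ := by
          refine setLIntegral_mono' hs.compl fun x hx => ENNReal.ofReal_le_ofReal ?_
          rw [← (even_two_mul n).pow_abs x]
          exact pow_le_pow_left₀ (abs_nonneg x) (le_of_not_ge hx) _
      _ = ENNReal.ofReal (a ^ (2 * n)) * μ {x : ℝ | a ≤ |x|}ᶜ := setLIntegral_const _ _
      _ ≤ ENNReal.ofReal (a ^ (2 * n)) * 1 := by gcongr; exact prob_le_one
      _ = _ := mul_one _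
  calc _ ≤ 2 + ENNReal.ofReal (a ^ (2 * n)) := add_le_add hfar hnear
    _ = ENNReal.ofReal (2 + a ^ (2 * n)) := by
        rw [ENNReal.ofReal_add zero_le_two (by positivity), ENNReal.ofReal_ofNat]
    _ ≤ _ := ENNReal.ofReal_le_ofReal (by linarith)

theorem finiteMoments_of_even {μ : Measure ℝ} [IsFiniteMeasure μ]
    (h : ∀ k : ℕ, ∫⁻ x, ENNReal.ofReal (x ^ (2 * (k + 1))) ∂μ < ∞) : FiniteMoments μ := by
  intro k
  have h1 : Integrable (fun x : ℝ => x ^ (2 * (k + 1))) μ := by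
    refine ⟨by fun_prop, ?_⟩
    rw [hasFiniteIntegral_iff_ofReal (.of_forall fun x => (even_two_mul (k + 1)).pow_nonneg x)]
    exact h k
  refine ((integrable_const (1 : ℝ)).add h1).mono' (by fun_prop) (.of_forall fun x => ?_)
  simp only [norm_pow, Real.norm_eq_abs, Pi.add_apply]
  rw [← (even_two_mul (k + 1)).pow_abs x]
  rcases le_total |x| 1 with hx | hx
  · have := pow_le_one₀ (n := k) (abs_nonneg x) hx
    have := pow_nonneg (abs_nonneg x) (2 * (k + 1))
    linarith
  · have := pow_le_pow_right₀ hx (by omega : k ≤ 2 * (k + 1))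
    linarith

/-- The threshold is the infimum of the superlevel set. The level need not be attained there, hence
the strict inequality `b < x`. -/
theorem exists_threshold {H : ℝ → ℝ} {x₀ : ℝ} (hmono : MonotoneOn H (Set.Ici x₀))
    (hlim : Filter.Tendsto H Filter.atTop Filter.atTop) (c : ℝ) :
    ∃ b, x₀ ≤ b ∧ (∀ x, b < x → c ≤ H x) ∧ ∀ x, x₀ ≤ x → c ≤ H x → b ≤ x := by
  set S : Set ℝ := {x | x₀ ≤ x ∧ c ≤ H x} with hS
  have hne : S.Nonempty :=
    ((Filter.eventually_ge_atTop x₀).and (hlim.eventually_ge_atTop c)).exists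
  have hbdd : BddBelow S := ⟨x₀, fun x hx => hx.1⟩
  refine ⟨sInf S, le_csInf hne fun x hx => hx.1, fun x hx => ?_,
    fun x hx hc => csInf_le hbdd ⟨hx, hc⟩⟩
  obtain ⟨y, hy, hyx⟩ := exists_lt_of_csInf_lt hne hx
  exact hy.2.trans (hmono hy.1 (hy.1.trans hyx.le) hyx.le)

/-- If the level `2 k + 4` of `H` is not reached before `b k`, divergence of `∫ H x / x ^ 2`
forces divergence of `∑ 1 / b k`. -/
theorem tsum_inv_threshold_eq_top {H : ℝ → ℝ} {x₀ : ℝ} (hx₀ : 1 < x₀) {b : ℕ → ℝ}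
    (hb₀ : ∀ k, x₀ ≤ b k) (hb : ∀ (k : ℕ) (x : ℝ), x₀ ≤ x → 2 * (k : ℝ) + 4 ≤ H x → b k ≤ x)
    (hH : ∫⁻ x in Set.Ioi x₀, ENNReal.ofReal (H x * x ^ (-2 : ℝ)) = ∞) :
    ∑' k, ENNReal.ofReal (b k)⁻¹ = ∞ := by
  set q : ℝ → ℝ≥0∞ := fun x => ENNReal.ofReal (x ^ (-2 : ℝ)) with hq
  have hqm : Measurable q := by fun_prop
  -- Layer-cake bound: `H x` exceeds `4` by at most twice the number of thresholds `b k` lying below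
  -- `x`.
  have hpt : ∀ x ∈ Set.Ioi x₀, ENNReal.ofReal (H x * x ^ (-2 : ℝ)) ≤
      4 * q x + ∑' k, 2 * (Set.Ici (b k)).indicator q x := by
    intro x hx
    have hx0 : 0 ≤ x ^ (-2 : ℝ) := Real.rpow_nonneg (by linarith [Set.mem_Ioi.1 hx]) _
    rcases le_or_gt (H x) 4 with h4 | h4
    · refine le_add_right ?_
      calc ENNReal.ofReal (H x * x ^ (-2 : ℝ)) ≤ ENNReal.ofReal (4 * x ^ (-2 : ℝ)) :=
            ENNReal.ofReal_le_ofReal (by gcongr)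
        _ = 4 * q x := by rw [ENNReal.ofReal_mul (by norm_num), ENNReal.ofReal_ofNat]
    · set N := ⌊(H x - 4) / 2⌋₊ + 1 with hN
      have hN1 : H x ≤ 4 + 2 * (N : ℝ) := by
        have := Nat.lt_floor_add_one ((H x - 4) / 2)
        rw [hN]
        push_cast
        linarith
      have hN2 : ∀ k ∈ Finset.range N, 2 * (Set.Ici (b k)).indicator q x = 2 * q x := by
        intro k hk
        have h1 : (k : ℝ) ≤ (H x - 4) / 2 := by
          refine (Nat.le_floor_iff (by linarith)).1 ?_
          have := Finset.mem_range.1 hk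
          omega
        have h2 : x ∈ Set.Ici (b k) := hb k x (le_of_lt hx) (by linarith)
        rw [Set.indicator_of_mem h2]
      have hN3 : (N : ℝ≥0∞) * (2 * q x) ≤ ∑' k, 2 * (Set.Ici (b k)).indicator q x := by
        refine le_trans (le_of_eq ?_) (ENNReal.sum_le_tsum (Finset.range N))
        rw [Finset.sum_congr rfl hN2]
        simp
      calc ENNReal.ofReal (H x * x ^ (-2 : ℝ))
          ≤ ENNReal.ofReal ((4 + 2 * (N : ℝ)) * x ^ (-2 : ℝ)) :=
            ENNReal.ofReal_le_ofReal (by gcongr)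
        _ = 4 * q x + N * (2 * q x) := by
            rw [ENNReal.ofReal_mul (by positivity), ENNReal.ofReal_add (by norm_num)
              (by positivity), ENNReal.ofReal_mul (by norm_num), ENNReal.ofReal_ofNat,
              ENNReal.ofReal_ofNat, ENNReal.ofReal_natCast]
            ring
        _ ≤ _ := by gcongr
  have hind : ∀ k, ∫⁻ x in Set.Ioi x₀, 2 * (Set.Ici (b k)).indicator q x ≤
      2 * ENNReal.ofReal (b k)⁻¹ := by
    intro k
    rw [lintegral_const_mul _ (hqm.indicator measurableSet_Ici)]
    gcongr
    refine (setLIntegral_le_lintegral _ _).trans_eq ?_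
    rw [lintegral_indicator measurableSet_Ici, setLIntegral_congr Ioi_ae_eq_Ici.symm,
      lintegral_Ioi_rpow_neg_two (by linarith [hb₀ k])]
  have hle : ∞ ≤ 4 * ENNReal.ofReal x₀⁻¹ + 2 * ∑' k, ENNReal.ofReal (b k)⁻¹ := by
    calc ∞ = ∫⁻ x in Set.Ioi x₀, ENNReal.ofReal (H x * x ^ (-2 : ℝ)) := hH.symm
      _ ≤ ∫⁻ x in Set.Ioi x₀, (4 * q x + ∑' k, 2 * (Set.Ici (b k)).indicator q x) :=
          setLIntegral_mono' measurableSet_Ioi hpt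
      _ = 4 * ENNReal.ofReal x₀⁻¹ +
          ∑' k, ∫⁻ x in Set.Ioi x₀, 2 * (Set.Ici (b k)).indicator q x := by
          rw [lintegral_add_left (hqm.const_mul _), lintegral_const_mul _ hqm,
            lintegral_Ioi_rpow_neg_two (by linarith), lintegral_tsum fun k =>
              ((hqm.indicator measurableSet_Ici).const_mul _).aemeasurable]
      _ ≤ 4 * ENNReal.ofReal x₀⁻¹ + ∑' k, 2 * ENNReal.ofReal (b k)⁻¹ := by
          gcongr with k
          exact hind k
      _ = _ := by rw [ENNReal.tsum_mul_left]
  by_contra hne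
  refine absurd (top_le_iff.1 hle) (ENNReal.add_ne_top.2 ⟨?_, ?_⟩)
  · exact ENNReal.mul_ne_top (by norm_num) ENNReal.ofReal_ne_top
  · exact ENNReal.mul_ne_top (by norm_num) hne

/-- Since `3 ≤ 3 ^ (2 (k + 1))`, the constant moves inside the power and survives the root only as a
factor `1 / 3`. -/
theorem inv_le_ofReal_rpow {m b : ℝ} (hb : 1 ≤ b) (k : ℕ) (hm : m ≤ 3 * b ^ (2 * (k + 1))) :
    3⁻¹ * ENNReal.ofReal b⁻¹ ≤ ENNReal.ofReal m ^ (-1 / (2 * ((k : ℝ) + 1))) := by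
  have hb0 : 0 < b := by linarith
  have h1 : m ≤ (3 * b) ^ (2 * (k + 1)) := by
    rw [mul_pow]
    refine hm.trans ?_
    gcongr
    exact le_self_pow₀ (by norm_num) (by omega)
  have h2 : ENNReal.ofReal ((3 * b) ^ (2 * (k + 1))) ^ (-1 / (2 * ((k : ℝ) + 1))) =
      3⁻¹ * ENNReal.ofReal b⁻¹ := by
    have h3 : (0 : ℝ) < 3 * b := by positivity
    rw [ENNReal.ofReal_rpow_of_pos (by positivity), ← Real.rpow_natCast,
      ← Real.rpow_mul h3.le]
    have h4 : ((2 * (k + 1) : ℕ) : ℝ) * (-1 / (2 * ((k : ℝ) + 1))) = -1 := by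
      push_cast
      field_simp
    rw [h4, Real.rpow_neg_one, mul_inv, ENNReal.ofReal_mul (by positivity),
      ENNReal.ofReal_inv_of_pos (by norm_num), ENNReal.ofReal_ofNat]
  rw [← h2, neg_div, ENNReal.rpow_neg, ENNReal.rpow_neg, ENNReal.inv_le_inv]
  exact ENNReal.rpow_le_rpow (ENNReal.ofReal_le_ofReal h1) (by positivity)

theorem pow_mul_le_of_le_log_ratio {y x : ℝ} (hy : 0 < y) (hx : 1 < x) {n : ℕ}
    (h : 2 * (n : ℝ) + 2 ≤ -Real.log y / Real.log x) : x ^ (2 * n) * y ≤ x ^ (-2 : ℝ) := by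
  have hx0 : 0 < x := by linarith
  have hlog : 0 < Real.log x := Real.log_pos hx
  rw [le_div_iff₀ hlog] at h
  rw [← Real.log_le_log_iff (by positivity) (by positivity), Real.log_mul (by positivity) hy.ne',
    Real.log_pow, Real.log_rpow hx0]
  push_cast
  linarith

/-- A symmetric density `f` with `- log f x / log x` nondecreasing, unbounded, and satisfying the
converse of Krein's logarithmic integral condition satisfies Carleman's condition. -/
theorem carleman_withDensity {f : ℝ → ℝ} (hf : Measurable f) (hsymm : ∀ x, f (-x) = f x)
    [IsProbabilityMeasure (volume.withDensity fun x => ENNReal.ofReal (f x))]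
    {x₀ : ℝ} (hx₀ : 1 < x₀) (hpos : ∀ x, x₀ ≤ |x| → 0 < f x)
    (hK : ∫⁻ x in {x : ℝ | x₀ ≤ |x|},
      ENNReal.ofReal (-Real.log (f x) / (x ^ 2 * Real.log |x|)) = ∞)
    (hmono : MonotoneOn (fun x => -Real.log (f x) / Real.log x) (Set.Ici x₀))
    (hlim : Filter.Tendsto (fun x => -Real.log (f x) / Real.log x) Filter.atTop Filter.atTop) :
    Carleman (volume.withDensity fun x => ENNReal.ofReal (f x)) := by
  -- The level is `2 (k + 1) + 2`: the moment order plus two, leaving the integrable tail `x ^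
  -- (-2)`.
  choose b hb₀ hbl hbr using fun k : ℕ => exists_threshold hmono hlim (2 * (k : ℝ) + 4)
  have hbound : ∀ k : ℕ, ∫⁻ x, ENNReal.ofReal (x ^ (2 * (k + 1)))
      ∂(volume.withDensity fun x => ENNReal.ofReal (f x)) ≤
        ENNReal.ofReal (3 * b k ^ (2 * (k + 1))) := by
    intro k
    refine lintegral_pow_withDensity_le hf hsymm (by linarith [hb₀ k]) fun x hx => ?_
    have hx1 : x₀ < x := (hb₀ k).trans_lt hx
    refine pow_mul_le_of_le_log_ratio (hpos x (hx1.le.trans (le_abs_self x))) (hx₀.trans hx1) ?_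
    have := hbl k x hx
    push_cast
    linarith
  have hfin := finiteMoments_of_even fun k => (hbound k).trans_lt ENNReal.ofReal_lt_top
  refine ⟨hfin, ?_⟩
  have hH : ∫⁻ x in Set.Ioi x₀,
      ENNReal.ofReal (-Real.log (f x) / Real.log x * x ^ (-2 : ℝ)) = ∞ := by
    have h1 := setLIntegral_le_abs_le_of_even
      (φ := fun x => ENNReal.ofReal (-Real.log (f x) / (x ^ 2 * Real.log |x|)))
      (fun x => by simp [hsymm]) x₀
    rw [hK, top_le_iff, ENNReal.mul_eq_top] at h1
    have h2 : ∫⁻ x in Set.Ioi x₀,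
        ENNReal.ofReal (-Real.log (f x) / (x ^ 2 * Real.log |x|)) = ∞ := by
      rcases h1 with h | h
      · exact h.2
      · exact absurd h.1 (by norm_num)
    rw [← h2]
    refine setLIntegral_congr_fun measurableSet_Ioi fun x hx => ?_
    have hx0 : 0 < x := by linarith [Set.mem_Ioi.1 hx]
    rw [abs_of_pos hx0, Real.rpow_neg hx0.le, Real.rpow_two, mul_comm (x ^ 2), ← div_div,
      div_eq_mul_inv _ (x ^ 2)]
  have hdiv := tsum_inv_threshold_eq_top hx₀ hb₀ hbr hH
  refine top_le_iff.1 ?_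
  calc ∞ = 3⁻¹ * ∑' k, ENNReal.ofReal (b k)⁻¹ := by
        rw [hdiv, ENNReal.mul_top (by simp)]
    _ = ∑' k, 3⁻¹ * ENNReal.ofReal (b k)⁻¹ := ENNReal.tsum_mul_left.symm
    _ ≤ _ := ENNReal.tsum_le_tsum fun k => by
        have hb1 : 1 ≤ b k := by linarith [hb₀ k]
        refine inv_le_ofReal_rpow hb1 k ?_
        rw [← ENNReal.ofReal_le_ofReal_iff (by positivity), ofReal_integral_eq_lintegral_ofReal
          (hfin _) (.of_forall fun x => (even_two_mul (k + 1)).pow_nonneg x)]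
        exact hbound k

/-! ### Symmetrization and determinacy of the square. -/

theorem map_neg_withDensity {f : ℝ → ℝ} (hsymm : ∀ x, f (-x) = f x) :
    (volume.withDensity fun x => ENNReal.ofReal (f x)).map (fun x => -x) =
      volume.withDensity fun x => ENNReal.ofReal (f x) := by
  ext s hs
  have hs' : MeasurableSet ((fun x : ℝ => -x) ⁻¹' s) := measurable_neg hs
  rw [Measure.map_apply measurable_neg hs, withDensity_apply _ hs', withDensity_apply _ hs]
  have h := (Measure.measurePreserving_neg (volume : Measure ℝ)).setLIntegral_comp_preimage_emb
    (MeasurableEquiv.neg ℝ).measurableEmbedding (fun x => ENNReal.ofReal (f x)) s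
  rw [← h]
  simp only [hsymm]

/-- The symmetric law of `± √Y` with independent fair sign, where `Y` has law `ν`. -/
noncomputable def symmSqrt (ν : Measure ℝ) : Measure ℝ :=
  (2⁻¹ : ℝ≥0∞) • (ν.map Real.sqrt + ν.map fun x => -Real.sqrt x)

theorem isProbabilityMeasure_symmSqrt (ν : Measure ℝ) [IsProbabilityMeasure ν] :
    IsProbabilityMeasure (symmSqrt ν) := by
  constructor
  rw [symmSqrt, Measure.smul_apply, Measure.add_apply,
    Measure.map_apply (by fun_prop) MeasurableSet.univ,
    Measure.map_apply (by fun_prop) MeasurableSet.univ]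
  simp only [Set.preimage_univ, measure_univ, smul_eq_mul, one_add_one_eq_two]
  exact ENNReal.inv_mul_cancel (by norm_num) (by norm_num)

theorem ae_nonneg_of_measure_compl_Ici {ν : Measure ℝ} (h : ν (Set.Ici 0)ᶜ = 0) :
    ∀ᵐ x ∂ν, 0 ≤ x :=
  measure_eq_zero_iff_ae_notMem.1 h |>.mono fun x hx => by simpa using hx

theorem map_sq_symmSqrt {ν : Measure ℝ} (h : ∀ᵐ x ∂ν, 0 ≤ x) :
    (symmSqrt ν).map (fun x => x ^ 2) = ν := by
  have hm : Measurable fun x : ℝ => x ^ 2 := by fun_prop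
  have h1 : (ν.map Real.sqrt).map (fun x => x ^ 2) = ν := by
    rw [Measure.map_map hm (by fun_prop)]
    conv_rhs => rw [← Measure.map_id (μ := ν)]
    exact Measure.map_congr (h.mono fun x hx => Real.sq_sqrt hx)
  have h2 : (ν.map fun x => -Real.sqrt x).map (fun x => x ^ 2) = ν := by
    rw [Measure.map_map hm (by fun_prop)]
    conv_rhs => rw [← Measure.map_id (μ := ν)]
    exact Measure.map_congr (h.mono fun x hx => by simp [Real.sq_sqrt hx])
  rw [symmSqrt, Measure.map_smul, Measure.map_add _ _ hm, h1, h2, ← two_smul ℝ≥0∞ ν, smul_smul,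
    ENNReal.inv_mul_cancel (by norm_num) (by norm_num), one_smul]

theorem integrable_sqrt_pow {ν : Measure ℝ} [IsFiniteMeasure ν] (hν : FiniteMoments ν) (k : ℕ) :
    Integrable (fun x => Real.sqrt x ^ k) ν := by
  refine ((integrable_const (1 : ℝ)).add (hν.integrable_abs_pow k)).mono' (by fun_prop)
    (.of_forall fun x => ?_)
  rw [Real.norm_of_nonneg (by positivity)]
  simp only [Pi.add_apply]
  have h0 := pow_nonneg (abs_nonneg x) k
  rcases le_total (Real.sqrt x) 1 with hx | hx
  · have := pow_le_one₀ (n := k) (Real.sqrt_nonneg x) hx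
    linarith
  · have h1 : Real.sqrt x ≤ |x| := by
      -- `Real.sqrt` is `0` on negative numbers, so `1 ≤ √x` excludes them.
      have hx0 : 0 ≤ x := by
        by_contra hneg
        rw [Real.sqrt_eq_zero_of_nonpos (by linarith)] at hx
        linarith
      rw [abs_of_nonneg hx0]
      nlinarith [Real.sq_sqrt hx0]
    have := pow_le_pow_left₀ (Real.sqrt_nonneg x) h1 k
    linarith

theorem integrable_neg_sqrt_pow {ν : Measure ℝ} [IsFiniteMeasure ν] (hν : FiniteMoments ν)
    (k : ℕ) : Integrable (fun x => (-Real.sqrt x) ^ k) ν := by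
  simpa only [neg_pow (Real.sqrt _)] using (integrable_sqrt_pow hν k).const_mul ((-1) ^ k)

theorem finiteMoments_symmSqrt {ν : Measure ℝ} [IsFiniteMeasure ν] (hν : FiniteMoments ν) :
    FiniteMoments (symmSqrt ν) := by
  intro k
  refine Integrable.smul_measure (Integrable.add_measure ?_ ?_) (by simp)
  · rw [integrable_map_measure (by fun_prop) (by fun_prop)]
    exact integrable_sqrt_pow hν k
  · rw [integrable_map_measure (by fun_prop) (by fun_prop)]
    exact integrable_neg_sqrt_pow hν k

theorem integral_pow_symmSqrt {ν : Measure ℝ} [IsFiniteMeasure ν] (hν : FiniteMoments ν) (k : ℕ) :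
    ∫ x, x ^ k ∂(symmSqrt ν) =
      2⁻¹ * (∫ x, Real.sqrt x ^ k ∂ν + ∫ x, (-Real.sqrt x) ^ k ∂ν) := by
  rw [symmSqrt, integral_smul_measure, integral_add_measure, integral_map (by fun_prop)
    (by fun_prop), integral_map (by fun_prop) (by fun_prop)]
  · simp
  · rw [integrable_map_measure (by fun_prop) (by fun_prop)]
    exact integrable_sqrt_pow hν k
  · rw [integrable_map_measure (by fun_prop) (by fun_prop)]
    exact integrable_neg_sqrt_pow hν k

/-- If `X` is symmetric and determinate on the line, then `X ^ 2` is determinate on the half-line. -/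
theorem MDeterminateOn.map_sq {μ : Measure ℝ} (hμ : MDeterminateOn Set.univ μ)
    (hsymm : μ.map (fun x => -x) = μ) : MDeterminateOn (Set.Ici 0) (μ.map fun x => x ^ 2) := by
  obtain ⟨-, hfin, huniq⟩ := hμ
  have hm : Measurable fun x : ℝ => x ^ 2 := by fun_prop
  refine ⟨?_, fun k => ?_, fun ν hν hν0 hνfin hmom => ?_⟩
  · rw [Measure.map_apply hm measurableSet_Ici.compl]
    convert measure_empty (μ := μ)
    ext x
    simp [sq_nonneg]
  · rw [integrable_map_measure (by fun_prop) (by fun_prop)]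
    simpa only [Function.comp_def, ← pow_mul] using hfin (2 * k)
  · have hpos := ae_nonneg_of_measure_compl_Ici hν0
    have := isProbabilityMeasure_symmSqrt ν
    have heq : symmSqrt ν = μ := by
      refine huniq _ this (by simp) (finiteMoments_symmSqrt hνfin) fun k => ?_
      rw [integral_pow_symmSqrt hνfin]
      -- Even moments of order `2 j` reduce to the `j`-th moment of `ν`; odd ones vanish on both
      -- sides by symmetry.
      rcases k.even_or_odd' with ⟨j, rfl | rfl⟩
      · have h1 : ∫ x, Real.sqrt x ^ (2 * j) ∂ν = ∫ x, x ^ j ∂ν :=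
          integral_congr_ae (hpos.mono fun x hx => by simp [pow_mul, Real.sq_sqrt hx])
        have h2 : ∫ x, (-Real.sqrt x) ^ (2 * j) ∂ν = ∫ x, x ^ j ∂ν :=
          integral_congr_ae (hpos.mono fun x hx => by simp [pow_mul, Real.sq_sqrt hx])
        rw [h1, h2, hmom, integral_map (by fun_prop) (by fun_prop)]
        simp only [← pow_mul]
        ring
      · have hodd : Odd (2 * j + 1) := odd_two_mul_add_one j
        have h1 : ∫ x, x ^ (2 * j + 1) ∂μ = -∫ x, x ^ (2 * j + 1) ∂μ := by
          conv_lhs => rw [← hsymm, integral_map (by fun_prop) (by fun_prop)]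
          simp only [hodd.neg_pow, integral_neg]
        simp only [hodd.neg_pow, integral_neg]
        linarith
    rw [← heq, map_sq_symmSqrt hpos]

theorem Carleman.mDeterminateOn_univ {μ : Measure ℝ} [IsProbabilityMeasure μ] (hμ : Carleman μ) :
    MDeterminateOn Set.univ μ :=
  ⟨by simp, hμ.1, fun _ _ _ hν hmom => hμ.eq_of_moments_eq hν hmom⟩

end MomentProblem

theorem theorem1 {Ω : Type*} [MeasurableSpace Ω] (P : Measure Ω) [IsProbabilityMeasure P]
    (X : Ω → ℝ) (hX : AEMeasurable X P)
    (f : ℝ → ℝ) (hf_meas : Measurable f) (hf_nonneg : ∀ x, 0 ≤ f x)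
    (hf_density : P.map X = volume.withDensity (fun x => ENNReal.ofReal (f x)))
    (hf_symm : ∀ x, f (-x) = f x)
    (x₀ : ℝ) (hx₀ : 1 < x₀)
    (hf_cont : ContinuousOn f {x : ℝ | x₀ ≤ |x|})
    (hf_pos : ∀ x : ℝ, x₀ ≤ |x| → 0 < f x)
    (hK : MomentProblem.IntegralEqTop
      (fun x => -Real.log (f x) / (x ^ 2 * Real.log |x|)) {x : ℝ | x₀ ≤ |x|})
    (hmono : MonotoneOn (fun x => -Real.log (f x) / Real.log x) (Set.Ici x₀))
    (hlim : Filter.Tendsto (fun x => -Real.log (f x) / Real.log x) Filter.atTop Filter.atTop) :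
    MomentProblem.Carleman (P.map X) ∧
      MomentProblem.MDeterminateOn Set.univ (P.map X) ∧
      MomentProblem.MDeterminateOn (Set.Ici 0) (P.map (fun ω => X ω ^ 2)) := by
  have hprob : IsProbabilityMeasure (P.map X) := Measure.isProbabilityMeasure_map hX
  have hsq : P.map (fun ω => X ω ^ 2) = (P.map X).map fun x => x ^ 2 :=
    (AEMeasurable.map_map_of_aemeasurable (g := fun x : ℝ => x ^ 2) (by fun_prop) hX).symm
  rw [hsq]
  rw [hf_density] at hprob ⊢
  have hC := MomentProblem.carleman_withDensity hf_meas hf_symm hx₀ hf_pos hK.1 hmono hlim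
  exact ⟨hC, hC.mDeterminateOn_univ,
    hC.mDeterminateOn_univ.map_sq (MomentProblem.map_neg_withDensity hf_symm)⟩
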